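/- For subsets $X,Y$ of a finite group $G$ let $$\mathrm{pr}(X,Y)=\frac{|\{(x,y)\in X\times Y : xy=yx\}|}{|X|\,|Y|}$$ be the probability that random elements $x\in X$ and $y\in Y$ commute. If a prime $p$ does not divide $|G|$, the trivial subgroup is regarded as the (unique) Sylow $p$-subgroup of $G$. Let $2'$ denote the set of odd primes, and let $\mathrm{pr}^*_G(2',2')$ be the maximum real number $\epsilon$ such that for every pair of distinct odd primes $p,q$ there are a Sylow $p$-subgroup $P$ and a Sylow $q$-subgroup $Q$ of $G$ with $\mathrm{pr}(P,Q)\ge\epsilon$. **Theorem.** Let $G$ be a finite group. If $\mathrm{pr}^*_G(2',2')>7/15$, then $G$ is soluble. The bound $7/15$ is sharp: the alternating group $A_5$ is not soluble and satisfies $\mathrm{pr}^*_{A_5}(2',2')=7/15$. -/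

import Mathlib

/-- `setPr X Y` is the probability that random elements `x ∈ X` and `y ∈ Y` commute, namely
`|{(x, y) ∈ X × Y : x y = y x}| / (|X| |Y|)`, for subsets `X`, `Y` of a finite group. -/
noncomputable def setPr {G : Type*} [Group G] (X Y : Set G) : ℝ :=
  ({z : G × G | z.1 ∈ X ∧ z.2 ∈ Y ∧ z.1 * z.2 = z.2 * z.1}.ncard : ℝ) /
    ((X.ncard : ℝ) * (Y.ncard : ℝ))

/-- The set of real numbers `ε` such that for all distinct primes `p ∈ π₁`, `q ∈ π₂` there are a
Sylow `p`-subgroup `P` and a Sylow `q`-subgroup `Q` of `G` with `pr(P, Q) ≥ ε`.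
(For a prime `p` not dividing `|G|` the only Sylow `p`-subgroup is the trivial one.) -/
def prStarBounds (G : Type*) [Group G] (π₁ π₂ : Set Nat.Primes) : Set ℝ :=
  {ε : ℝ | ∀ p ∈ π₁, ∀ q ∈ π₂, p ≠ q →
    ∃ (P : Sylow (p : ℕ) G) (Q : Sylow (q : ℕ) G), ε ≤ setPr (P : Set G) (Q : Set G)}

/-- `prStar G π₁ π₂` is the maximum of the set `prStarBounds G π₁ π₂`; that the supremum is a
maximum is shown in `isGreatest_prStar`. -/
noncomputable def prStar (G : Type*) [Group G] (π₁ π₂ : Set Nat.Primes) : ℝ :=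
  sSup (prStarBounds G π₁ π₂)

/-- The set `2'` of all odd primes. -/
def oddPrimes : Set Nat.Primes := {⟨2, Nat.prime_two⟩}ᶜ

/-- As soon as there is at least one pair of distinct primes in question, `prStar` is attained. -/
theorem isGreatest_prStar (G : Type*) [Group G] [Finite G] (π₁ π₂ : Set Nat.Primes)
    (h : ∃ p ∈ π₁, ∃ q ∈ π₂, p ≠ q) :
    IsGreatest (prStarBounds G π₁ π₂) (prStar G π₁ π₂) := by
  classical
  let V : Set ℝ := Set.range (fun z : Set G × Set G => setPr z.1 z.2)
  have hV : V.Finite := Set.finite_range _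
  obtain ⟨p₀, hp₀, q₀, hq₀, hpq₀⟩ := h
  have hne : (prStarBounds G π₁ π₂).Nonempty := by
    refine ⟨sInf V, fun p _ q _ _ => ⟨default, default, ?_⟩⟩
    exact csInf_le hV.bddBelow ⟨(_, _), rfl⟩
  have hbdd : BddAbove (prStarBounds G π₁ π₂) := by
    refine ⟨sSup V, fun ε hε => ?_⟩
    obtain ⟨P, Q, hPQ⟩ := hε p₀ hp₀ q₀ hq₀ hpq₀
    exact hPQ.trans (le_csSup hV.bddAbove ⟨(_, _), rfl⟩)
  refine ⟨fun p hp q hq hpq => ?_, fun ε hε => le_csSup hbdd hε⟩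
  obtain ⟨z, hz⟩ := Finite.exists_max
    (fun z : Sylow (p : ℕ) G × Sylow (q : ℕ) G => setPr (z.1 : Set G) (z.2 : Set G))
  refine ⟨z.1, z.2, csSup_le hne fun ε hε => ?_⟩
  obtain ⟨P, Q, hPQ⟩ := hε p hp q hq hpq
  exact hPQ.trans (hz (P, Q))

/-
If `P` and `Q` are a `p`-group and a `q`-group that do not centralize each other, then they commute
with probability at most `1 - (1 - 1/p)(1 - 1/q)`, which is at most `7/15` for distinct odd primes.
So `pr*_G(2', 2') > 7/15` makes Sylow subgroups for distinct odd primes commute. Then a nontrivial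
element in the center of a Sylow subgroup of odd order has a conjugacy class of `2`-power size, and
Burnside's class size theorem puts it in the center of `G` when `G` is simple. The hypothesis
passes to normal subgroups and quotients, so solubility follows by induction.

In `A₅` the Sylow subgroups of odd order have order `1`, `3` or `5`, and the pairs with a trivial
entry already force the probability to be at least `7/15`.
-/

theorem isIntegral_of_isOfFinOrder {R : Type*} [Ring R] {x : R} (hx : IsOfFinOrder x) :
    IsIntegral ℤ x := by
  obtain ⟨n, hn, hpow⟩ := isOfFinOrder_iff_pow_eq_one.mp hx
  exact IsIntegral.of_pow hn (hpow ▸ isIntegral_one)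

theorem forall_eq_of_sum_eq_card_nsmul_of_norm_le {ι E : Type*} [Fintype ι]
    [NormedAddCommGroup E] [InnerProductSpace ℝ E] {f : ι → E} {a : E} (hf : ∀ i, ‖f i‖ ≤ ‖a‖)
    (hsum : ∑ i, f i = Fintype.card ι • a) : ∀ i, f i = a := by
  have hinner : ∑ i, inner ℝ (f i) a = Fintype.card ι * ‖a‖ ^ 2 := by
    rw [← sum_inner, hsum, ← Nat.cast_smul_eq_nsmul ℝ, real_inner_smul_left,
      real_inner_self_eq_norm_sq]
  have hdist : ∑ i, ‖f i - a‖ ^ 2 ≤ 0 :=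
    calc ∑ i, ‖f i - a‖ ^ 2 = ∑ i, ‖f i‖ ^ 2 - Fintype.card ι * ‖a‖ ^ 2 := by
          simp only [norm_sub_sq_real, Finset.sum_add_distrib, Finset.sum_sub_distrib,
            ← Finset.mul_sum, hinner, Finset.sum_const, Finset.card_univ, nsmul_eq_mul]
          ring
      _ = ∑ i, (‖f i‖ ^ 2 - ‖a‖ ^ 2) := by simp
      _ ≤ 0 := Finset.sum_nonpos fun i _ => sub_nonpos.mpr (by gcongr; exact hf i)
  have hzero := (Finset.sum_eq_zero_iff_of_nonneg fun _ _ => sq_nonneg _).mp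
    (hdist.antisymm (Finset.sum_nonneg fun _ _ => sq_nonneg _))
  exact fun i => by simpa [sub_eq_zero] using hzero i (Finset.mem_univ i)

theorem eq_zero_or_forall_eq_of_isOfFinOrder_of_numberField {K ι : Type*} [Field K] [NumberField K]
    [Fintype ι] [Nonempty ι] {f : ι → K} (hf : ∀ i, IsOfFinOrder (f i)) {a : K}
    (ha : IsIntegral ℤ a) (hmean : ∑ i, f i = Fintype.card ι • a) : a = 0 ∨ ∀ i, f i = a := by
  refine or_iff_not_imp_left.mpr fun ha0 => ?_
  have hnorm {z : K} (φ : K →+* ℂ) (hz : IsOfFinOrder z) : ‖φ z‖ = 1 :=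
    ((φ : K →* ℂ).isOfFinOrder hz).norm_eq_one
  have hsum (φ : K →+* ℂ) : ∑ i, φ (f i) = Fintype.card ι • φ a := by
    rw [← map_sum, hmean, map_nsmul]
  have hle (φ : K →+* ℂ) : ‖φ a‖ ≤ 1 := by
    have h : Fintype.card ι * ‖φ a‖ ≤ Fintype.card ι * 1 := by
      simpa [hsum, hnorm φ (hf _), nsmul_eq_mul] using norm_sum_le Finset.univ fun i => φ (f i)
    exact le_of_mul_le_mul_left h (by exact_mod_cast Fintype.card_pos)
  obtain ⟨n, hn, hpow⟩ := NumberField.Embeddings.pow_eq_one_of_norm_le_one K ℂ ha0 ha hle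
  have hafin : IsOfFinOrder a := isOfFinOrder_iff_pow_eq_one.mpr ⟨n, hn, hpow⟩
  obtain ⟨φ⟩ : Nonempty (K →+* ℂ) := inferInstance
  have heq := forall_eq_of_sum_eq_card_nsmul_of_norm_le
    (fun i => by rw [hnorm φ (hf i), hnorm φ hafin]) (hsum φ)
  exact fun i => φ.injective (heq i)

theorem eq_zero_or_forall_eq_of_isOfFinOrder {k ι : Type*} [Field k] [CharZero k] [Fintype ι]
    {f : ι → k} (hf : ∀ i, IsOfFinOrder (f i)) {a : k} (ha : IsIntegral ℤ a)
    (hmean : ∑ i, f i = Fintype.card ι • a) : a = 0 ∨ ∀ i, f i = a := by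
  rcases isEmpty_or_nonempty ι with _ | _
  · exact Or.inr isEmptyElim
  let K := IntermediateField.adjoin ℚ (Set.range f)
  have hfK (i : ι) : f i ∈ K := IntermediateField.subset_adjoin ℚ _ ⟨i, rfl⟩
  have haK : a ∈ K := by
    have hcard : (Fintype.card ι : k) ≠ 0 := Nat.cast_ne_zero.mpr Fintype.card_ne_zero
    rw [← inv_mul_cancel_left₀ hcard a, ← nsmul_eq_mul (Fintype.card ι), ← hmean]
    exact K.mul_mem (K.inv_mem (natCast_mem K _)) (sum_mem fun i _ => hfK i)
  have : FiniteDimensional ℚ K := IntermediateField.finiteDimensional_adjoin <| by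
    rintro _ ⟨i, rfl⟩
    exact (isIntegral_of_isOfFinOrder (hf i)).tower_top
  have : NumberField K := {}
  have hfK' (i : ι) : IsOfFinOrder (⟨f i, hfK i⟩ : K) :=
    (Function.Injective.isOfFinOrder_iff (f := (K.val : K →* k)) K.val.injective).mp (hf i)
  rcases eq_zero_or_forall_eq_of_isOfFinOrder_of_numberField hfK' (a := ⟨a, haK⟩)
    ((isIntegral_algHom_iff (K.val.restrictScalars ℤ) K.val.injective).mp ha)
    (Subtype.ext (by simpa using hmean)) with h | h
  · exact Or.inl (congrArg Subtype.val h)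
  · exact Or.inr fun i => congrArg Subtype.val (h i)

theorem isOfFinOrder_of_mem_spectrum {k R : Type*} [Field k] [Ring R] [Algebra k R] {x : R}
    (hx : IsOfFinOrder x) {c : k} (hc : c ∈ spectrum k x) : IsOfFinOrder c := by
  obtain ⟨n, hn, hpow⟩ := isOfFinOrder_iff_pow_eq_one.mp hx
  have : Nontrivial R := not_subsingleton_iff_nontrivial.mp fun _ => by
    simp [spectrum.of_subsingleton] at hc
  have hcn : c ^ n ∈ spectrum k (1 : R) := hpow ▸ spectrum.pow_mem_pow x n hc
  rw [spectrum.one_eq] at hcn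
  exact isOfFinOrder_iff_pow_eq_one.mpr ⟨n, hn, hcn⟩

section Matrix

variable {k n : Type*} [Field k] [Fintype n] [DecidableEq n] {A : Matrix n n k}

theorem isOfFinOrder_of_mem_roots_charpoly (hA : IsOfFinOrder A) {c : k}
    (hc : c ∈ A.charpoly.roots) : IsOfFinOrder c :=
  isOfFinOrder_of_mem_spectrum hA <|
    Matrix.mem_spectrum_iff_isRoot_charpoly.mpr (Polynomial.isRoot_of_mem_roots hc)

variable [IsAlgClosed k]

theorem isIntegral_trace_of_isOfFinOrder (hA : IsOfFinOrder A) : IsIntegral ℤ A.trace := by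
  rw [Matrix.trace_eq_sum_roots_charpoly]
  exact IsIntegral.multiset_sum fun c hc =>
    isIntegral_of_isOfFinOrder (isOfFinOrder_of_mem_roots_charpoly hA hc)

theorem eq_scalar_of_isOfFinOrder_of_roots_charpoly [CharZero k] (hA : IsOfFinOrder A) {a : k}
    (ha : ∀ c ∈ A.charpoly.roots, c = a) : A = Matrix.scalar n a := by
  obtain ⟨m, hm, hpow⟩ := isOfFinOrder_iff_pow_eq_one.mp hA
  have hsep : (minpoly k A).Separable :=
    (Polynomial.separable_X_pow_sub_C 1 (Nat.cast_ne_zero.mpr hm.ne') one_ne_zero).of_dvd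
      (minpoly.dvd k A (by simp [hpow]))
  have hroots : (minpoly k A).roots ≤ (Polynomial.X - Polynomial.C a).roots := by
    refine (Multiset.le_iff_subset (Polynomial.nodup_roots hsep)).mpr fun c hc => ?_
    rw [Polynomial.roots_X_sub_C, Multiset.mem_singleton]
    exact ha c <| Multiset.mem_of_le
      (Polynomial.roots.le_of_dvd A.charpoly_monic.ne_zero (Matrix.minpoly_dvd_charpoly A)) hc
  have hdvd : minpoly k A ∣ Polynomial.X - Polynomial.C a :=
    (IsAlgClosed.splits _).dvd_of_roots_le_roots hsep.ne_zero hroots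
  have hzero := minpoly.dvd_iff.mp hdvd
  rwa [map_sub, Polynomial.aeval_X, Polynomial.aeval_C, sub_eq_zero] at hzero

theorem eq_zero_or_eq_scalar_of_isIntegral [CharZero k] (hA : IsOfFinOrder A) {a : k}
    (ha : IsIntegral ℤ a) (htr : A.trace = Fintype.card n • a) :
    a = 0 ∨ A = Matrix.scalar n a := by
  classical
  have hcard : Fintype.card A.charpoly.roots = Fintype.card n := by
    rw [Multiset.card_coe, ← (IsAlgClosed.splits A.charpoly).natDegree_eq_card_roots,
      Matrix.charpoly_natDegree_eq_dim]
  have hmean : ∑ c : A.charpoly.roots, (c : k) = Fintype.card A.charpoly.roots • a := by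
    rw [hcard, ← htr, Matrix.trace_eq_sum_roots_charpoly, Multiset.sum_eq_sum_coe]
  refine (eq_zero_or_forall_eq_of_isOfFinOrder (fun c : A.charpoly.roots =>
    isOfFinOrder_of_mem_roots_charpoly hA Multiset.coe_mem) ha hmean).imp_right fun h => ?_
  exact eq_scalar_of_isOfFinOrder_of_roots_charpoly hA fun c hc =>
    h ⟨c, ⟨0, Multiset.count_pos.mpr hc⟩⟩

end Matrix

theorem dvd_of_isIntegral_of_mul_eq {k : Type*} [Field k] [CharZero k] {a b : ℤ} {x : k}
    (hx : IsIntegral ℤ x) (h : a * x = b) : a ∣ b := by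
  rcases eq_or_ne a 0 with rfl | ha
  · simp_all [eq_comm]
  have hq : x = ((b / a : ℚ) : k) := by
    have ha' : (a : k) ≠ 0 := Int.cast_ne_zero.mpr ha
    push_cast
    rw [eq_div_iff ha', mul_comm, h]
  obtain ⟨z, rfl⟩ := hx.exists_int_iff_exists_rat.mp ⟨_, hq⟩
  exact ⟨z, by exact_mod_cast h.symm⟩

theorem trace_mulLeft_pi_matrix {k ι : Type*} [CommRing k] [Fintype ι] {d : ι → Type*}
    [∀ i, Fintype (d i)] (A : ∀ i, Matrix (d i) (d i) k) :
    LinearMap.trace k _ (LinearMap.mulLeft k A) = ∑ i, Fintype.card (d i) • (A i).trace := by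
  classical
  have hrepr (i : ι) (a b : d i) :
      (Matrix.stdBasis k (d i) (d i)).repr (A i * Matrix.single a b 1) (a, b) = A i a a := by
    simp [Matrix.stdBasis, Pi.basis_repr]
  rw [LinearMap.trace_eq_matrix_trace k (Pi.basis fun i => Matrix.stdBasis k (d i) (d i))]
  simp only [Matrix.trace, Matrix.diag, LinearMap.toMatrix_apply, Fintype.sum_sigma,
    Fintype.sum_prod_type, Pi.basis_repr, Pi.basis_apply, LinearMap.mulLeft_apply]
  simp [Matrix.stdBasis_eq_single, hrepr, Finset.smul_sum]

theorem trace_mulLeft_of {k G : Type*} [CommRing k] [Group G] [Fintype G] [DecidableEq G] (g : G) :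
    LinearMap.trace k _ (LinearMap.mulLeft k (MonoidAlgebra.of k G g)) =
      if g = 1 then (Fintype.card G : k) else 0 := by
  have hdiag (x : G) : (MonoidAlgebra.basis G k).repr
      (MonoidAlgebra.of k G g * MonoidAlgebra.single x 1) x = if g = 1 then 1 else 0 := by
    change (MonoidAlgebra.of k G g * MonoidAlgebra.single x 1).coeff x = _
    simp [Finsupp.single_apply]
  rw [LinearMap.trace_eq_matrix_trace k (MonoidAlgebra.basis G k)]
  simp only [Matrix.trace, Matrix.diag, LinearMap.toMatrix_apply, LinearMap.mulLeft_apply,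
    MonoidAlgebra.basis_apply, hdiag]
  simp

section Representation

variable {k G n : Type*} [Field k] [Group G] [Fintype n] [DecidableEq n]

/-- A matrix representation is absolutely irreducible if its matrices span the full matrix
algebra; by Burnside's theorem on matrix algebras this agrees, for `n` nonempty, with
irreducibility over every extension field of `k`. -/
def IsAbsolutelyIrreducible (ρ : G →* Matrix n n k) : Prop :=
  Submodule.span k (Set.range ρ) = ⊤

variable {ρ : G →* Matrix n n k}

theorem IsAbsolutelyIrreducible.exists_eq_scalar_of_commute (hρ : IsAbsolutelyIrreducible ρ)
    {A : Matrix n n k} (hA : ∀ x, Commute (ρ x) A) : ∃ c, A = Matrix.scalar n c := by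
  have hcomm (B : Matrix n n k) : Commute B A := by
    have hB : B ∈ Submodule.span k (Set.range ρ) := hρ ▸ Submodule.mem_top
    induction hB using Submodule.span_induction with
    | mem _ hx => obtain ⟨x, rfl⟩ := hx; exact hA x
    | zero => exact Commute.zero_left A
    | add _ _ _ _ hx hy => exact hx.add_left hy
    | smul c _ _ hx => exact hx.smul_left c
  obtain ⟨c, hc⟩ := Matrix.mem_range_scalar_iff_commute_single'.mpr fun _ _ => hcomm _
  exact ⟨c, hc.symm⟩

theorem map_mul_sum_map [Fintype G] {R : Type*} [Semiring R] (ρ : G →* R) (x : G) :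
    ρ x * ∑ y, ρ y = ∑ y, ρ y := by
  simp only [Finset.mul_sum, ← map_mul]
  exact Equiv.sum_comp (Equiv.mulLeft x) ρ

theorem sum_map_mul_map [Fintype G] {R : Type*} [Semiring R] (ρ : G →* R) (x : G) :
    (∑ y, ρ y) * ρ x = ∑ y, ρ y := by
  simp only [Finset.sum_mul, ← map_mul]
  exact Equiv.sum_comp (Equiv.mulRight x) ρ

theorem IsAbsolutelyIrreducible.sum_eq_zero_or_eq_one [Fintype G]
    (hρ : IsAbsolutelyIrreducible ρ) : ∑ x, ρ x = 0 ∨ ρ = 1 := by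
  obtain ⟨c, hc⟩ := hρ.exists_eq_scalar_of_commute
    fun x => (map_mul_sum_map ρ x).trans (sum_map_mul_map ρ x).symm
  rcases eq_or_ne c 0 with rfl | hc0
  · exact Or.inl (hc.trans (map_zero _))
  · refine Or.inr (MonoidHom.ext fun x => ?_)
    have hunit : IsUnit (∑ y, ρ y) := hc ▸ (isUnit_iff_ne_zero.mpr hc0).map (Matrix.scalar n)
    exact hunit.mul_left_injective ((map_mul_sum_map ρ x).trans (one_mul _).symm)

theorem isIntegral_sum_map [Finite G] {R : Type*} [Ring R] (ρ : G →* R) (s : Finset G) :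
    IsIntegral ℤ (∑ x ∈ s, ρ x) := by
  simpa using (IsIntegral.of_finite ℤ (∑ x ∈ s, MonoidAlgebra.of ℤ G x)).map
    (MonoidAlgebra.lift ℤ R G ρ)

theorem commute_sum_isConj [Fintype G] {R : Type*} [Semiring R] (ρ : G →* R) (g x : G)
    [DecidablePred (IsConj g)] : Commute (ρ x) (∑ y with IsConj g y, ρ y) := by
  rw [Commute, SemiconjBy, Finset.mul_sum, Finset.sum_mul]
  refine Finset.sum_equiv (MulAut.conj x).toEquiv (fun y => ?_) fun y _ => ?_
  · have hxy : IsConj y (MulAut.conj x y) := isConj_iff.mpr ⟨x, rfl⟩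
    rw [Finset.mem_filter_univ, Finset.mem_filter_univ]
    exact ⟨fun h => IsConj.trans h hxy, fun h => IsConj.trans h hxy.symm⟩
  · simp [← map_mul]

theorem trace_map_eq_of_isConj {x y : G} (h : IsConj x y) : (ρ x).trace = (ρ y).trace := by
  obtain ⟨c, rfl⟩ := isConj_iff.mp h
  rw [map_mul, map_mul, Matrix.trace_mul_comm, ← mul_assoc, ← map_mul]
  simp

/-- `w` is the value at the class sum of the central character attached to `ρ`. -/
theorem IsAbsolutelyIrreducible.exists_isIntegral_card_nsmul_eq [Finite G] [Nonempty n]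
    (hρ : IsAbsolutelyIrreducible ρ) (g : G) :
    ∃ w : k, IsIntegral ℤ w ∧
      Fintype.card n • w = (conjugatesOf g).ncard • (ρ g).trace := by
  classical
  have := Fintype.ofFinite G
  obtain ⟨w, hw⟩ := hρ.exists_eq_scalar_of_commute fun x => commute_sum_isConj ρ g x
  have hcard : (conjugatesOf g).ncard = ({x | IsConj g x} : Finset G).card := by
    rw [← Set.ncard_coe_finset, Finset.coe_filter_univ]
    rfl
  refine ⟨w, ?_, ?_⟩
  · have hint := isIntegral_sum_map ρ {x | IsConj g x}
    rw [hw] at hint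
    exact (isIntegral_algebraMap_iff (algebraMap k (Matrix n n k)).injective).mp hint
  · calc Fintype.card n • w = (∑ x with IsConj g x, ρ x).trace := by
          rw [hw]; simp [Matrix.trace]
      _ = ∑ x with IsConj g x, (ρ g).trace := by
          rw [Matrix.trace_sum]
          exact Finset.sum_congr rfl fun x hx =>
            (trace_map_eq_of_isConj (Finset.mem_filter.mp hx).2).symm
      _ = (conjugatesOf g).ncard • (ρ g).trace := by rw [Finset.sum_const, hcard]

theorem IsAbsolutelyIrreducible.trace_eq_zero_or_eq_scalar [Finite G] [CharZero k] [IsAlgClosed k]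
    [Nonempty n] (hρ : IsAbsolutelyIrreducible ρ) {g : G}
    (h : (Fintype.card n).Coprime (conjugatesOf g).ncard) :
    (ρ g).trace = 0 ∨ ∃ c, ρ g = Matrix.scalar n c := by
  have hfin : IsOfFinOrder (ρ g) := ρ.isOfFinOrder (isOfFinOrder_of_finite g)
  obtain ⟨w, hw, hwt⟩ := hρ.exists_isIntegral_card_nsmul_eq g
  obtain ⟨u, v, huv⟩ := Nat.isCoprime_iff_coprime.mpr h
  have huv' : (u : k) * Fintype.card n + v * (conjugatesOf g).ncard = 1 := by exact_mod_cast huv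
  have hmean : (ρ g).trace = Fintype.card n • (u * (ρ g).trace + v * w) := by
    rw [nsmul_eq_mul, nsmul_eq_mul] at hwt
    rw [nsmul_eq_mul]
    linear_combination -(ρ g).trace * huv' - v * hwt
  have hint (z : ℤ) : IsIntegral ℤ (z : k) := isIntegral_algebraMap (x := z)
  rcases eq_zero_or_eq_scalar_of_isIntegral hfin
    (((hint u).mul (isIntegral_trace_of_isOfFinOrder hfin)).add ((hint v).mul hw)) hmean
    with h0 | hscalar
  · exact Or.inl (by rw [hmean, h0, smul_zero])
  · exact Or.inr ⟨_, hscalar⟩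

end Representation

theorem isAbsolutelyIrreducible_of_surjective_lift {k G n : Type*} [Field k] [Group G] [Fintype n]
    [DecidableEq n] {ρ : G →* Matrix n n k}
    (hρ : Function.Surjective (MonoidAlgebra.lift k (Matrix n n k) G ρ)) :
    IsAbsolutelyIrreducible ρ := by
  refine eq_top_iff.mpr fun A _ => ?_
  obtain ⟨a, rfl⟩ := hρ A
  induction a using MonoidAlgebra.induction_on with
  | of x => exact Submodule.subset_span ⟨x, (MonoidAlgebra.lift_of ρ x).symm⟩
  | add a b ha hb => rw [map_add]; exact add_mem (ha trivial) (hb trivial)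
  | smul c a ha => rw [map_smul]; exact Submodule.smul_mem _ c (ha trivial)

theorem exists_isAbsolutelyIrreducible_sum_degree_nsmul_trace (k G : Type*) [Field k]
    [IsAlgClosed k] [Group G] [Fintype G] [DecidableEq G] [NeZero (Fintype.card G : k)] :
    ∃ (N : ℕ) (d : Fin N → ℕ) (ρ : ∀ i, G →* Matrix (Fin (d i)) (Fin (d i)) k),
      (∀ i, NeZero (d i)) ∧ (∀ i, IsAbsolutelyIrreducible (ρ i)) ∧
      ∀ g, ∑ i, d i • (ρ i g).trace = if g = 1 then (Fintype.card G : k) else 0 := by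
  have : NeZero (Nat.card G : k) := by rwa [Nat.card_eq_fintype_card]
  obtain ⟨N, d, hd, ⟨e⟩⟩ :=
    IsSemisimpleRing.exists_algEquiv_pi_matrix_of_isAlgClosed k (MonoidAlgebra k G)
  let φ (i : Fin N) : MonoidAlgebra k G →ₐ[k] Matrix (Fin (d i)) (Fin (d i)) k :=
    (Pi.evalAlgHom k _ i).comp e.toAlgHom
  refine ⟨N, d, fun i => (MonoidAlgebra.lift k _ G).symm (φ i), hd,
    fun i => isAbsolutelyIrreducible_of_surjective_lift ?_, fun g => ?_⟩
  · rw [Equiv.apply_symm_apply]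
    exact (Function.surjective_eval i).comp e.surjective
  · have hconj : e.toLinearEquiv.conj (LinearMap.mulLeft k (MonoidAlgebra.of k G g)) =
        LinearMap.mulLeft k (e (MonoidAlgebra.of k G g)) :=
      LinearMap.ext fun x => by simp [LinearEquiv.conj_apply]
    rw [← trace_mulLeft_of, ← LinearMap.trace_conj' _ e.toLinearEquiv, hconj,
      trace_mulLeft_pi_matrix]
    simp [φ]

section RegularCharacter

variable {k G ι : Type*} [Field k] [CharZero k] [Group G] [Fintype G] [DecidableEq G] [Fintype ι]
  {d : ι → ℕ} {ρ : ∀ i, G →* Matrix (Fin (d i)) (Fin (d i)) k}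

open scoped Classical in
theorem sum_sq_degree_trivial (hρ : ∀ i, IsAbsolutelyIrreducible (ρ i))
    (hreg : ∀ g, ∑ i, d i • (ρ i g).trace = if g = 1 then (Fintype.card G : k) else 0) :
    ∑ i with ρ i = 1, (d i ^ 2 : k) = 1 := by
  have hterm (i : ι) : d i • (∑ g, ρ i g).trace =
      if ρ i = 1 then (Fintype.card G : k) * d i ^ 2 else 0 := by
    split_ifs with hi
    · simp only [hi, MonoidHom.one_apply, Finset.sum_const, Finset.card_univ, Matrix.trace_smul,
        Matrix.trace_one, Fintype.card_fin, ← Nat.cast_smul_eq_nsmul k, smul_eq_mul]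
      ring
    · rw [(hρ i).sum_eq_zero_or_eq_one.resolve_right hi, Matrix.trace_zero, smul_zero]
  have hcard : (Fintype.card G : k) ≠ 0 := Nat.cast_ne_zero.mpr Fintype.card_ne_zero
  refine mul_left_cancel₀ hcard ?_
  calc (Fintype.card G : k) * ∑ i with ρ i = 1, (d i ^ 2 : k)
      = ∑ i, d i • (∑ g, ρ i g).trace := by
        rw [Finset.sum_congr rfl fun i _ => hterm i, ← Finset.sum_filter, Finset.mul_sum]
    _ = ∑ g, ∑ i, d i • (ρ i g).trace := by
        simp only [Matrix.trace_sum, Finset.smul_sum]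
        exact Finset.sum_comm
    _ = Fintype.card G * 1 := by simp only [hreg, Fintype.sum_ite_eq', mul_one]

open scoped Classical in
theorem sum_degree_nsmul_trace_nontrivial (hρ : ∀ i, IsAbsolutelyIrreducible (ρ i))
    (hreg : ∀ g, ∑ i, d i • (ρ i g).trace = if g = 1 then (Fintype.card G : k) else 0)
    {g : G} (hg : g ≠ 1) : ∑ i with ρ i ≠ 1, d i • (ρ i g).trace = -1 := by
  have htriv : ∑ i with ρ i = 1, d i • (ρ i g).trace = 1 := by
    rw [← sum_sq_degree_trivial hρ hreg]
    refine Finset.sum_congr rfl fun i hi => ?_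
    rw [(Finset.mem_filter.mp hi).2, MonoidHom.one_apply, Matrix.trace_one, Fintype.card_fin,
      nsmul_eq_mul, sq]
  have hsplit := Finset.sum_filter_add_sum_filter_not Finset.univ (fun i => ρ i = 1)
    fun i => d i • (ρ i g).trace
  rw [htriv, hreg, if_neg hg] at hsplit
  exact (neg_eq_of_add_eq_zero_right hsplit).symm

end RegularCharacter

section Burnside

variable {G : Type*} [Group G] [IsSimpleGroup G] {g : G}

theorem injective_of_isSimpleGroup_of_ne_one {M : Type*} [MulOneClass M] {f : G →* M} (hf : f ≠ 1) :
    Function.Injective f :=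
  (MonoidHom.ker_eq_bot_iff f).mp <|
    (MonoidHom.normal_ker f).eq_bot_or_eq_top.resolve_right fun htop =>
      hf (MonoidHom.ker_eq_top_iff.mp htop)

theorem IsAbsolutelyIrreducible.exists_isIntegral_card_nsmul_trace_eq_mul {k n : Type*} [Finite G]
    [Field k] [CharZero k] [IsAlgClosed k] [Fintype n] [DecidableEq n] [Nonempty n]
    {ρ : G →* Matrix n n k} (hρ : IsAbsolutelyIrreducible ρ) (hρ1 : ρ ≠ 1)
    (hg : g ∉ Subgroup.center G) {p j : ℕ} (hp : p.Prime) (hcard : (conjugatesOf g).ncard = p ^ j) :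
    ∃ b, IsIntegral ℤ b ∧ Fintype.card n • (ρ g).trace = p * b := by
  by_cases hdvd : p ∣ Fintype.card n
  · obtain ⟨m, hm⟩ := hdvd
    exact ⟨m • (ρ g).trace,
      (isIntegral_trace_of_isOfFinOrder (ρ.isOfFinOrder (isOfFinOrder_of_finite g))).smul m,
      by rw [hm, mul_smul, nsmul_eq_mul p]⟩
  · have hcop : (Fintype.card n).Coprime (conjugatesOf g).ncard :=
      hcard ▸ ((hp.coprime_iff_not_dvd.mpr hdvd).pow_left j).symm
    have hnonscalar : ¬ ∃ c, ρ g = Matrix.scalar n c := by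
      rintro ⟨c, hc⟩
      refine hg (Subgroup.mem_center_iff.mpr fun x => injective_of_isSimpleGroup_of_ne_one hρ1 ?_)
      rw [map_mul, map_mul, hc]
      exact (Matrix.scalar_commute c (Commute.all c) _).symm
    refine ⟨0, isIntegral_zero, ?_⟩
    rw [(hρ.trace_eq_zero_or_eq_scalar hcop).resolve_right hnonscalar, smul_zero, mul_zero]

theorem mem_center_of_ncard_conjugatesOf_eq_prime_pow [Finite G] {p j : ℕ} (hp : p.Prime)
    (hcard : (conjugatesOf g).ncard = p ^ j) : g ∈ Subgroup.center G := by
  classical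
  by_contra hg
  -- The nontrivial part of the regular character is `-1` at `g`, but each of its terms is `p` times
  -- an algebraic integer.
  have hg1 : g ≠ 1 := fun h => hg (h ▸ one_mem _)
  have := Fintype.ofFinite G
  obtain ⟨N, d, ρ, _, hρ, hreg⟩ := exists_isAbsolutelyIrreducible_sum_degree_nsmul_trace ℂ G
  have hterm (i : Fin N) (hi : ρ i ≠ 1) :
      ∃ b, IsIntegral ℤ b ∧ d i • (ρ i g).trace = p * b := by
    simpa using (hρ i).exists_isIntegral_card_nsmul_trace_eq_mul hi hg hp hcard
  choose! b hb hb' using hterm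
  have hint : IsIntegral ℤ (∑ i with ρ i ≠ 1, b i) :=
    IsIntegral.sum _ fun i hi => hb i (Finset.mem_filter.mp hi).2
  have hmul : ((p : ℤ) : ℂ) * ∑ i with ρ i ≠ 1, b i = ((-1 : ℤ) : ℂ) := by
    push_cast
    rw [← sum_degree_nsmul_trace_nontrivial hρ hreg hg1, Finset.mul_sum]
    exact Finset.sum_congr rfl fun i hi => (hb' i (Finset.mem_filter.mp hi).2).symm
  have hdvd : (p : ℤ) ∣ -1 := dvd_of_isIntegral_of_mul_eq hint hmul
  exact hp.one_lt.ne' (by simpa [Int.natCast_dvd] using hdvd)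

end Burnside

local instance fact_prime_coe (p : Nat.Primes) : Fact (p : ℕ).Prime := ⟨p.2⟩

section CommutingSylows

variable {G : Type*} [Group G]

/-- For all distinct primes `p ∈ π₁` and `q ∈ π₂` there are a Sylow `p`-subgroup and a Sylow
`q`-subgroup of `G` that centralize each other, which is the case `ε = 1` in `prStarBounds`. -/
def HasCommutingSylows (G : Type*) [Group G] (π₁ π₂ : Set Nat.Primes) : Prop :=
  ∀ p ∈ π₁, ∀ q ∈ π₂, p ≠ q →
    ∃ (P : Sylow (p : ℕ) G) (Q : Sylow (q : ℕ) G),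
      (P : Subgroup G) ≤ Subgroup.centralizer (Q : Set G)

theorem relIndex_dvd_index_of_normal_right (H N : Subgroup G) [N.Normal] (hN : N.relIndex H ≠ 0) :
    H.relIndex N ∣ H.index := by
  have hdiamond : (H ⊓ N).relIndex H * H.relIndex (H ⊔ N) =
      (H ⊓ N).relIndex N * N.relIndex (H ⊔ N) := by
    rw [Subgroup.relIndex_mul_relIndex _ _ _ inf_le_left le_sup_left,
      Subgroup.relIndex_mul_relIndex _ _ _ inf_le_right le_sup_right]
  rw [Subgroup.inf_relIndex_left, Subgroup.inf_relIndex_right, Subgroup.relIndex_sup_right,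
    mul_comm] at hdiamond
  exact Nat.eq_of_mul_eq_mul_right (Nat.pos_of_ne_zero hN) hdiamond ▸
    Subgroup.relIndex_dvd_index_of_le le_sup_left

theorem exists_sylow_coe_eq_subgroupOf [Finite G] {p : ℕ} [Fact p.Prime] (P : Sylow p G)
    (N : Subgroup G) [N.Normal] :
    ∃ S : Sylow p N, (S : Subgroup N) = (P : Subgroup G).subgroupOf N := by
  have hindex : (P : Subgroup G).relIndex N ∣ (P : Subgroup G).index :=
    relIndex_dvd_index_of_normal_right (P : Subgroup G) N (N.subgroupOf P).index_ne_zero_of_finite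
  have hpgroup : IsPGroup p ((P : Subgroup G).subgroupOf N) := P.isPGroup'.comap_subtype
  exact ⟨hpgroup.toSylow fun hdvd => P.not_dvd_index (hdvd.trans hindex), rfl⟩

variable {π₁ π₂ : Set Nat.Primes}

theorem HasCommutingSylows.of_normal [Finite G] (h : HasCommutingSylows G π₁ π₂) (N : Subgroup G)
    [N.Normal] : HasCommutingSylows N π₁ π₂ := by
  intro p hp q hq hpq
  obtain ⟨P, Q, hPQ⟩ := h p hp q hq hpq
  obtain ⟨P', hP'⟩ := exists_sylow_coe_eq_subgroupOf P N
  obtain ⟨Q', hQ'⟩ := exists_sylow_coe_eq_subgroupOf Q N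
  refine ⟨P', Q', ?_⟩
  rw [hP', ← Sylow.coe_coe, hQ']
  exact fun x hx y hy => Subtype.ext (hPQ hx y hy)

theorem HasCommutingSylows.of_surjective [Finite G] {H : Type*} [Group H]
    (h : HasCommutingSylows G π₁ π₂) {f : G →* H} (hf : Function.Surjective f) :
    HasCommutingSylows H π₁ π₂ := by
  intro p hp q hq hpq
  obtain ⟨P, Q, hPQ⟩ := h p hp q hq hpq
  refine ⟨P.mapSurjective hf, Q.mapSurjective hf, ?_⟩
  rintro _ ⟨x, hx, rfl⟩ _ ⟨y, hy, rfl⟩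
  exact Commute.map (hPQ hx y hy) f

theorem ncard_conjugatesOf_eq_index_centralizer (g : G) :
    (conjugatesOf g).ncard = (Subgroup.centralizer {g}).index := by
  have hstab : (Subgroup.centralizer {g}).index = (MulAction.stabilizer (ConjAct G) g).index :=
    congrArg Subgroup.index (ConjAct.stabilizer_eq_centralizer g).symm
  rw [hstab, MulAction.index_stabilizer, ConjAct.orbit_eq_carrier_conjClasses]
  rfl

theorem not_dvd_ncard_conjugatesOf_of_mem_centralizer [Finite G] {q : ℕ} [Fact q.Prime]
    {Q : Sylow q G} {z : G} (hz : z ∈ Subgroup.centralizer (Q : Set G)) :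
    ¬ q ∣ (conjugatesOf z).ncard := fun hdvd => by
  have hle : (Q : Subgroup G) ≤ Subgroup.centralizer {z} :=
    fun y hy => Subgroup.mem_centralizer_singleton_iff.mpr (hz y hy)
  rw [ncard_conjugatesOf_eq_index_centralizer] at hdvd
  exact Q.not_dvd_index (hdvd.trans (Subgroup.index_dvd_of_le hle))

theorem HasCommutingSylows.not_dvd_ncard_conjugatesOf [Finite G] (h : HasCommutingSylows G π₁ π₂)
    {p q : Nat.Primes} (hp : p ∈ π₁) (hq : q ∈ π₂) (hpq : p ≠ q) {P : Sylow (p : ℕ) G} {z : G}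
    (hz : z ∈ P) : ¬ (q : ℕ) ∣ (conjugatesOf z).ncard := by
  obtain ⟨P', Q, hPQ⟩ := h p hp q hq hpq
  obtain ⟨g, rfl⟩ := MulAction.exists_smul_eq G P' P
  obtain ⟨w, hw, hwz⟩ := hz
  have hconj : IsConj w z := isConj_iff.mpr ⟨g, hwz⟩
  rw [← hconj.conjugatesOf_eq]
  exact not_dvd_ncard_conjugatesOf_of_mem_centralizer (hPQ hw)

theorem HasCommutingSylows.exists_ne_one_forall_not_dvd_ncard_conjugatesOf [Finite G]
    (h : HasCommutingSylows G π₁ π₂) {p : Nat.Primes} (hp : p ∈ π₁) (hdvd : (p : ℕ) ∣ Nat.card G) :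
    ∃ z : G, z ≠ 1 ∧ ∀ q ∈ π₂, ¬ (q : ℕ) ∣ (conjugatesOf z).ncard := by
  let P : Sylow (p : ℕ) G := default
  have : Nontrivial P := (Subgroup.nontrivial_iff_ne_bot _).mpr (P.ne_bot_of_dvd_card hdvd)
  have := P.isPGroup'.center_nontrivial
  obtain ⟨⟨z, hz⟩, hz1⟩ := exists_ne (1 : Subgroup.center P)
  have hzP : (z : G) ∈ Subgroup.centralizer (P : Set G) := fun y hy =>
    congrArg Subtype.val (Subgroup.mem_center_iff.mp hz ⟨y, hy⟩)
  refine ⟨z, fun h1 => hz1 (Subtype.ext (Subtype.ext h1)), fun q hq => ?_⟩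
  rcases eq_or_ne p q with rfl | hpq
  · exact not_dvd_ncard_conjugatesOf_of_mem_centralizer hzP
  · exact h.not_dvd_ncard_conjugatesOf hp hq hpq z.2

theorem exists_eq_prime_pow_of_forall_ne_not_dvd {n : ℕ} (hn : n ≠ 0) (r : Nat.Primes)
    (h : ∀ q ≠ r, ¬ (q : ℕ) ∣ n) : ∃ j, n = r ^ j :=
  ⟨_, Nat.eq_prime_pow_of_unique_prime_dvd hn fun {q} hq hdvd =>
    congrArg Subtype.val (not_imp_not.mp (h ⟨q, hq⟩) hdvd)⟩

theorem HasCommutingSylows.isSolvable_of_isSimpleGroup [Finite G] [IsSimpleGroup G]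
    {r : Nat.Primes} (h : HasCommutingSylows G {r}ᶜ {r}ᶜ) : Group.IsSolvable G := by
  by_cases hr : ∃ p ≠ r, (p : ℕ) ∣ Nat.card G
  · obtain ⟨p, hp, hdvd⟩ := hr
    obtain ⟨z, hz1, hz⟩ := h.exists_ne_one_forall_not_dvd_ncard_conjugatesOf hp hdvd
    obtain ⟨j, hj⟩ := exists_eq_prime_pow_of_forall_ne_not_dvd
      ((Set.ncard_pos (Set.toFinite _)).mpr ⟨z, mem_conjugatesOf_self⟩).ne' r hz
    have hzcenter := mem_center_of_ncard_conjugatesOf_eq_prime_pow r.2 hj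
    have hcenter : Subgroup.center G = ⊤ :=
      (inferInstance : (Subgroup.center G).Normal).eq_bot_or_eq_top.resolve_left fun hbot =>
        hz1 (Subgroup.mem_bot.mp (hbot ▸ hzcenter))
    exact Group.isSolvable_of_comm fun a b =>
      Subgroup.mem_center_iff.mp (hcenter ▸ Subgroup.mem_top b) a
  · push Not at hr
    obtain ⟨j, hj⟩ := exists_eq_prime_pow_of_forall_ne_not_dvd Nat.card_pos.ne' r hr
    have := (IsPGroup.of_card hj).isNilpotent
    infer_instance

theorem HasCommutingSylows.isSolvable [Finite G] {r : Nat.Primes}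
    (h : HasCommutingSylows G {r}ᶜ {r}ᶜ) : Group.IsSolvable G := by
  induction hn : Nat.card G using Nat.strong_induction_on generalizing G with
  | _ n ih =>
  subst hn
  rcases subsingleton_or_nontrivial G with _ | _
  · infer_instance
  by_cases hsimple : ∀ N : Subgroup G, N.Normal → N = ⊥ ∨ N = ⊤
  · have : IsSimpleGroup G := ⟨hsimple⟩
    exact h.isSolvable_of_isSimpleGroup
  · push Not at hsimple
    obtain ⟨N, _, hbot, htop⟩ := hsimple
    have hN : Nat.card N < Nat.card G := by
      rw [← N.card_mul_index]
      exact lt_mul_of_one_lt_right Nat.card_pos (N.one_lt_index_of_ne_top htop)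
    have hquot : Nat.card (G ⧸ N) < Nat.card G := by
      rw [← N.card_mul_index]
      exact lt_mul_of_one_lt_left Nat.card_pos (N.one_lt_card_iff_ne_bot.mpr hbot)
    exact (Group.isSolvable_iff_subgroup_quotient N).mpr ⟨ih _ hN (h.of_normal N) rfl,
      ih _ hquot (h.of_surjective (QuotientGroup.mk'_surjective N)) rfl⟩

end CommutingSylows

section CommutingProbability

variable {G : Type*} [Group G]

theorem prime_le_relIndex_of_not_le {p : ℕ} [Fact p.Prime] {H K : Subgroup G} [Finite K]
    (hK : IsPGroup p K) (h : ¬ K ≤ H) : p ≤ H.relIndex K := by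
  obtain ⟨n, hn⟩ := hK.index (H.subgroupOf K)
  have hn0 : n ≠ 0 := by
    rintro rfl
    exact h (Subgroup.relIndex_eq_one.mp hn)
  rw [Subgroup.relIndex, hn]
  exact Nat.le_self_pow hn0 p

theorem ncard_setOf_mul_comm_eq_sum (P Q : Subgroup G) [Fintype P] [Finite Q] :
    {z : G × G | z.1 ∈ (P : Set G) ∧ z.2 ∈ (Q : Set G) ∧ z.1 * z.2 = z.2 * z.1}.ncard =
      ∑ x : P, Nat.card ((Subgroup.centralizer {(x : G)}).subgroupOf Q) := by
  rw [← Nat.card_sigma, ← Nat.card_coe_set_eq]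
  exact Nat.card_congr
    { toFun := fun z => ⟨⟨z.1.1, z.2.1⟩, ⟨z.1.2, z.2.2.1⟩,
        Subgroup.mem_centralizer_singleton_iff.mpr z.2.2.2.symm⟩
      invFun := fun w => ⟨(w.1, w.2.1), w.1.2, w.2.1.2,
        (Subgroup.mem_centralizer_singleton_iff.mp w.2.2).symm⟩
      left_inv := fun _ => rfl
      right_inv := fun _ => rfl }

theorem card_subgroupOf_eq_card_mul_inv_relIndex (H K : Subgroup G) [Finite K] :
    (Nat.card (H.subgroupOf K) : ℝ) = Nat.card K * (H.relIndex K : ℝ)⁻¹ := by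
  rw [Subgroup.relIndex, ← (H.subgroupOf K).card_mul_index, Nat.cast_mul,
    mul_inv_cancel_right₀ (Nat.cast_ne_zero.mpr Subgroup.index_ne_zero_of_finite)]

theorem setPr_eq_sum_inv_relIndex_div_card (P Q : Subgroup G) [Fintype P] [Finite Q] :
    setPr (P : Set G) (Q : Set G) =
      (∑ x : P, ((Subgroup.centralizer {(x : G)}).relIndex Q : ℝ)⁻¹) / Nat.card P := by
  have hQ : (Nat.card Q : ℝ) ≠ 0 := Nat.cast_ne_zero.mpr Nat.card_pos.ne'
  rw [setPr, ncard_setOf_mul_comm_eq_sum, Nat.cast_sum,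
    Finset.sum_congr rfl fun x _ => card_subgroupOf_eq_card_mul_inv_relIndex _ _,
    ← Finset.mul_sum, mul_comm (Set.ncard _ : ℝ)]
  exact mul_div_mul_left _ _ hQ

theorem card_filter_mem_eq_card_mul_inv_relIndex (H K : Subgroup G) [Fintype K]
    [DecidablePred fun x : K => (x : G) ∈ H] :
    (Finset.card {x : K | (x : G) ∈ H} : ℝ) = Nat.card K * (H.relIndex K : ℝ)⁻¹ := by
  rw [← Fintype.card_subtype, ← Nat.card_eq_fintype_card]
  exact card_subgroupOf_eq_card_mul_inv_relIndex H K

theorem setPr_le_of_not_le_centralizer {p q : ℕ} [hp : Fact p.Prime] [hq : Fact q.Prime]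
    {P Q : Subgroup G} [Finite P] [Finite Q] (hP : IsPGroup p P) (hQ : IsPGroup q Q)
    (hPQ : ¬ P ≤ Subgroup.centralizer (Q : Set G)) :
    setPr (P : Set G) (Q : Set G) ≤ 1 - (1 - (p : ℝ)⁻¹) * (1 - (q : ℝ)⁻¹) := by
  classical
  have := Fintype.ofFinite P
  have hp0 : (0 : ℝ) < p := Nat.cast_pos.mpr hp.out.pos
  have hq0 : (0 : ℝ) < q := Nat.cast_pos.mpr hq.out.pos
  have hterm (x : P) : ((Subgroup.centralizer {(x : G)}).relIndex Q : ℝ)⁻¹ ≤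
      (q : ℝ)⁻¹ + if (x : G) ∈ Subgroup.centralizer (Q : Set G) then 1 - (q : ℝ)⁻¹ else 0 := by
    split_ifs with hx
    · rw [add_sub_cancel]
      exact Nat.cast_inv_le_one _
    · rw [add_zero]
      refine inv_anti₀ hq0 (Nat.cast_le.mpr (prime_le_relIndex_of_not_le hQ fun hle => hx ?_))
      exact fun y hy => Subgroup.mem_centralizer_singleton_iff.mp (hle hy)
  have hcentral : ((Subgroup.centralizer (Q : Set G)).relIndex P : ℝ)⁻¹ ≤ (p : ℝ)⁻¹ :=
    inv_anti₀ hp0 (Nat.cast_le.mpr (prime_le_relIndex_of_not_le hP hPQ))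
  have hq1 : 0 ≤ 1 - (q : ℝ)⁻¹ := sub_nonneg.mpr (Nat.cast_inv_le_one q)
  have hP0 : (0 : ℝ) < Nat.card P := Nat.cast_pos.mpr Nat.card_pos
  rw [setPr_eq_sum_inv_relIndex_div_card, div_le_iff₀ hP0]
  calc ∑ x : P, ((Subgroup.centralizer {(x : G)}).relIndex Q : ℝ)⁻¹
    _ ≤ ∑ x : P, ((q : ℝ)⁻¹ +
        if (x : G) ∈ Subgroup.centralizer (Q : Set G) then 1 - (q : ℝ)⁻¹ else 0) :=
      Finset.sum_le_sum fun x _ => hterm x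
    _ = Nat.card P * (q : ℝ)⁻¹ + Nat.card P *
        ((Subgroup.centralizer (Q : Set G)).relIndex P : ℝ)⁻¹ * (1 - (q : ℝ)⁻¹) := by
      rw [Finset.sum_add_distrib, Finset.sum_const, Finset.card_univ, ← Finset.sum_filter,
        Finset.sum_const, nsmul_eq_mul, nsmul_eq_mul, Nat.card_eq_fintype_card,
        card_filter_mem_eq_card_mul_inv_relIndex, Nat.card_eq_fintype_card]
    _ ≤ Nat.card P * (q : ℝ)⁻¹ + Nat.card P * (p : ℝ)⁻¹ * (1 - (q : ℝ)⁻¹) := by gcongr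
    _ = (1 - (1 - (p : ℝ)⁻¹) * (1 - (q : ℝ)⁻¹)) * Nat.card P := by ring

theorem le_setPr (P Q : Subgroup G) [Finite P] [Finite Q] :
    1 - (1 - (Nat.card P : ℝ)⁻¹) * (1 - (Nat.card Q : ℝ)⁻¹) ≤ setPr (P : Set G) (Q : Set G) := by
  classical
  have := Fintype.ofFinite P
  have hterm (x : P) : (Nat.card Q : ℝ)⁻¹ + (if x = 1 then 1 - (Nat.card Q : ℝ)⁻¹ else 0) ≤
      ((Subgroup.centralizer {(x : G)}).relIndex Q : ℝ)⁻¹ := by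
    split_ifs with hx
    · have hone : (Subgroup.centralizer {(x : G)}).relIndex Q = 1 :=
        Subgroup.relIndex_eq_one.mpr fun y _ =>
          Subgroup.mem_centralizer_singleton_iff.mpr (by simp [hx])
      simp [hone]
    · rw [add_zero]
      refine inv_anti₀ (Nat.cast_pos.mpr (Nat.pos_of_ne_zero ?_)) (Nat.cast_le.mpr ?_)
      · exact Subgroup.index_ne_zero_of_finite
      · exact Nat.le_of_dvd Nat.card_pos (Subgroup.relIndex_dvd_card _ Q)
  have hP0 : (0 : ℝ) < Nat.card P := Nat.cast_pos.mpr Nat.card_pos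
  rw [setPr_eq_sum_inv_relIndex_div_card, le_div_iff₀ hP0]
  calc (1 - (1 - (Nat.card P : ℝ)⁻¹) * (1 - (Nat.card Q : ℝ)⁻¹)) * Nat.card P
    _ = Nat.card P * (Nat.card Q : ℝ)⁻¹ + (1 - (Nat.card Q : ℝ)⁻¹) := by
      field_simp
      ring
    _ = ∑ x : P, ((Nat.card Q : ℝ)⁻¹ + if x = 1 then 1 - (Nat.card Q : ℝ)⁻¹ else 0) := by
      rw [Finset.sum_add_distrib, Finset.sum_const, Finset.card_univ, nsmul_eq_mul,
        Fintype.sum_ite_eq', Nat.card_eq_fintype_card]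
    _ ≤ ∑ x : P, ((Subgroup.centralizer {(x : G)}).relIndex Q : ℝ)⁻¹ :=
      Finset.sum_le_sum fun x _ => hterm x

theorem eight_div_fifteen_le_one_sub_inv_mul_one_sub_inv {p q : ℕ} (hp : p.Prime) (hq : q.Prime)
    (hp2 : p ≠ 2) (hq2 : q ≠ 2) (hpq : p ≠ q) : 8 / 15 ≤ (1 - (p : ℝ)⁻¹) * (1 - (q : ℝ)⁻¹) := by
  wlog hlt : p < q generalizing p q
  · rw [mul_comm]
    exact this hq hp hq2 hp2 hpq.symm (by lia)
  have hp3 : 3 ≤ p := by have := hp.two_le; lia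
  have hq5 : 5 ≤ q := hq.five_le_of_ne_two_of_ne_three hq2 (by lia)
  calc (8 / 15 : ℝ) = (1 - ((3 : ℕ) : ℝ)⁻¹) * (1 - ((5 : ℕ) : ℝ)⁻¹) := by norm_num
    _ ≤ (1 - (p : ℝ)⁻¹) * (1 - (q : ℝ)⁻¹) := by
      gcongr
      exact sub_nonneg.mpr (Nat.cast_inv_le_one p)

end CommutingProbability

section OddPrimes

theorem isGreatest_prStar_oddPrimes (G : Type*) [Group G] [Finite G] :
    IsGreatest (prStarBounds G oddPrimes oddPrimes) (prStar G oddPrimes oddPrimes) :=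
  isGreatest_prStar G _ _ ⟨⟨3, Nat.prime_three⟩, Subtype.coe_ne_coe.mp (by decide),
    ⟨5, Nat.prime_five⟩, Subtype.coe_ne_coe.mp (by decide), Subtype.coe_ne_coe.mp (by decide)⟩

theorem isSolvable_of_lt_prStar_oddPrimes {G : Type*} [Group G] [Finite G]
    (h : 7 / 15 < prStar G oddPrimes oddPrimes) : Group.IsSolvable G := by
  have hcomm : HasCommutingSylows G oddPrimes oddPrimes := by
    intro p hp q hq hpq
    obtain ⟨P, Q, hPQ⟩ := (isGreatest_prStar_oddPrimes G).1 p hp q hq hpq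
    refine ⟨P, Q, not_not.mp fun hnot => ?_⟩
    have hle := setPr_le_of_not_le_centralizer P.isPGroup' Q.isPGroup' hnot
    have hprimes := eight_div_fifteen_le_one_sub_inv_mul_one_sub_inv p.2 q.2
      (Subtype.coe_ne_coe.mpr hp) (Subtype.coe_ne_coe.mpr hq) (Subtype.coe_ne_coe.mpr hpq)
    rw [Sylow.coe_coe, Sylow.coe_coe] at hle
    linarith
  exact hcomm.isSolvable

theorem not_isSolvable_alternatingGroup_fin_five :
    ¬ Group.IsSolvable (alternatingGroup (Fin 5)) := fun _ =>
  Equiv.Perm.not_isSolvable_fin_5 <|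
    Group.isSolvable_of_ker_le_range (alternatingGroup (Fin 5)).subtype
      (Equiv.Perm.sign (α := Fin 5)) (Subgroup.range_subtype _).ge

theorem card_sylow_dvd_of_coprime {G : Type*} [Group G] [Finite G] {p m n : ℕ}
    (hG : Nat.card G = m * n) (hpm : p.Coprime m) (P : Sylow p G) : Nat.card P ∣ n := by
  obtain ⟨k, hk⟩ := P.isPGroup'.exists_card_dvd_pow
  exact ((hpm.pow_left k).coprime_dvd_left hk).dvd_of_dvd_mul_left
    (hG ▸ (P : Subgroup G).card_subgroup_dvd_card)

theorem one_sub_inv_mul_one_sub_inv_le_of_dvd_fifteen {a b : ℕ} (ha : a ∣ 15) (hb : b ∣ 15)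
    (hab : a.Coprime b) : (1 - (a : ℝ)⁻¹) * (1 - (b : ℝ)⁻¹) ≤ 8 / 15 := by
  have hnat : ∀ a ∈ Nat.divisors 15, ∀ b ∈ Nat.divisors 15, a.Coprime b →
      7 * (a * b) + 15 ≤ 15 * (a + b) := by decide
  have ha0 : (0 : ℝ) < a := Nat.cast_pos.mpr (Nat.pos_of_dvd_of_pos ha (by norm_num))
  have hb0 : (0 : ℝ) < b := Nat.cast_pos.mpr (Nat.pos_of_dvd_of_pos hb (by norm_num))
  have hreal : 7 * ((a : ℝ) * b) + 15 ≤ 15 * (a + b) := by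
    exact_mod_cast hnat a (by simpa using ha) b (by simpa using hb) hab
  field_simp
  linarith

theorem seven_div_fifteen_le_prStar_oddPrimes {G : Type*} [Group G] [Finite G] {k : ℕ}
    (hG : Nat.card G = 2 ^ k * 15) : 7 / 15 ≤ prStar G oddPrimes oddPrimes := by
  refine (isGreatest_prStar_oddPrimes G).2 fun p hp q hq hpq => ?_
  have hdvd {r : Nat.Primes} (hr : r ∈ oddPrimes) (R : Sylow (r : ℕ) G) : Nat.card R ∣ 15 := by
    have hr2 : (r : ℕ).Coprime 2 :=
      (Nat.coprime_primes r.2 Nat.prime_two).mpr (Subtype.coe_ne_coe.mpr hr)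
    exact card_sylow_dvd_of_coprime hG (hr2.pow_right k) R
  let P : Sylow (p : ℕ) G := default
  let Q : Sylow (q : ℕ) G := default
  have hcoprime : (Nat.card P).Coprime (Nat.card Q) :=
    IsPGroup.coprime_card_of_ne (p : ℕ) q (Subtype.coe_ne_coe.mpr hpq) _ _ P.isPGroup' Q.isPGroup'
  have hle := le_setPr (P : Subgroup G) Q
  have hfifteen := one_sub_inv_mul_one_sub_inv_le_of_dvd_fifteen (hdvd hp P) (hdvd hq Q) hcoprime
  rw [Sylow.coe_coe, Sylow.coe_coe] at hle
  exact ⟨P, Q, by linarith⟩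

theorem prStar_alternatingGroup_fin_five :
    prStar (alternatingGroup (Fin 5)) oddPrimes oddPrimes = 7 / 15 := by
  have hcard : Nat.card (alternatingGroup (Fin 5)) = 2 ^ 2 * 15 := by
    rw [nat_card_alternatingGroup]
    simp [Nat.factorial]
  exact le_antisymm (not_lt.mp fun h =>
    not_isSolvable_alternatingGroup_fin_five (isSolvable_of_lt_prStar_oddPrimes h))
    (seven_div_fifteen_le_prStar_oddPrimes hcard)

end OddPrimes

/-- Finite groups `G` with `pr*_G(2', 2') > 7/15` are soluble, and the bound is sharp: equality
`pr*_G(2', 2') = 7/15` holds for the insoluble group `A₅`. -/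
theorem theorem1p4 :
    (∀ (G : Type*) [Group G] [Finite G],
      7 / 15 < prStar G oddPrimes oddPrimes → Group.IsSolvable G) ∧
    (prStar (alternatingGroup (Fin 5)) oddPrimes oddPrimes = 7 / 15 ∧
      ¬ Group.IsSolvable (alternatingGroup (Fin 5))) := by
  exact ⟨fun G _ _ h => isSolvable_of_lt_prStar_oddPrimes h, prStar_alternatingGroup_fin_five,
    not_isSolvable_alternatingGroup_fin_five⟩
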